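/- Let $G$ be a finite connected weighted graph with vertex set $V(G)$, $|V(G)|\ge 2$, given by symmetric weights $\mu_{xy}=\mu_{yx}\ge 0$, where $\{x,y\}$ is an edge if and only if $\mu_{xy}>0$. Put $\mu_x:=\sum_{y}\mu_{xy}$ and $m(G):=\sum_x\mu_x$. Let $\mathbf P_z$ be the law of the discrete time random walk $(X_t)_{t\in\mathbb Z_{\ge 0}}$ on $V(G)$ with $X_0=z$ and transition probabilities $P(x,y)=\mu_{xy}/\mu_x$, and define its local times by $L_t(x):=\mu_x^{-1}\sum_{i=0}^{t-1}\mathbf 1_{\{X_i=x\}}$ for integers $t\ge 0$ (so $L_0(x)=0$). Let $$\mathcal E(f,f):=\tfrac12\sum_{x,y\in V(G)}(f(x)-f(y))^2\mu_{xy}.$$ Let $R$ be the resistance metric: $R(x,x)=0$ and, for $x\ne y$, $R(x,y)^{-1}:=\inf\{\mathcal E(f,f): f:V(G)\to\mathbb R,\ f(x)=0,\ f(y)=1\}$. Put $r(G):=\max_{x,y}R(x,y)$ and $\tilde R(x,y):=R(x,y)/r(G)$. Below, $t$ ranges over integers. **Theorem.** (a) There is a universal constant $c_2>0$ such that for each $T>0$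 there is a constant $c_1>0$, depending only on $T$ (in particular neither constant depends on $G$), with the following property: for every such $G$, all $x,y,z\in V(G)$ with $x\neq y$, and every $\lambda\ge 0$, $$\mathbf P_z\Big(\max_{0\le t\le T m(G) r(G)} r(G)^{-1}\,|L_t(x)-L_t(y)|\ \ge\ \lambda\sqrt{\tilde R(x,y)}\Big)\ \le\ c_1e^{-c_2\lambda}.$$ (b) For every such $G$, all $x,y,z\in V(G)$ with $x\ne y$, every $\lambda\ge 0$ and every real $L\ge 1$, $$\mathbf P_z\Big(\max_{t\ge 0}\Big|\,L\wedge\frac{L_t(x)}{r(G)}-L\wedge\frac{L_t(y)}{r(G)}\Big|\ \ge\ \lambda\sqrt{\tilde R(x,y)}\Big)\ \le\ 2e^{\frac12-\frac{\lambda^2}{8L}},$$ where $a\wedge b:=\min\{a,b\}$. -/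

import Mathlib

open MeasureTheory ProbabilityTheory

universe u

/-- A finite connected weighted graph on the vertex set `V`, given by its symmetric weight
(conductance) function. The edges are the pairs `{x, y}` with `0 < weight x y`. A vertex may
carry a positive weight `weight x x`; ordinary simple graphs are the case where
`weight x x = 0` for all `x`. -/
structure WeightedGraph (V : Type u) where
  weight : V → V → ℝ
  symm : ∀ x y, weight x y = weight y x
  nonneg : ∀ x y, 0 ≤ weight x y
  connected : (SimpleGraph.fromRel fun x y => 0 < weight x y).Connected

namespace WeightedGraph

noncomputable section

variable {V : Type u} [Fintype V]

/-- The vertex weight `μ_x = ∑_y μ_{xy}`. -/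
def vertexWeight (G : WeightedGraph V) (x : V) : ℝ := ∑ y, G.weight x y

/-- The total mass `m(G) = μ(V(G))`. -/
def totalMass (G : WeightedGraph V) : ℝ := ∑ x, G.vertexWeight x

/-- The Dirichlet form `𝓔(f, g)`; pairs that are not edges have weight `0`, so the sum may be
taken over all ordered pairs of vertices. -/
def dirichletForm (G : WeightedGraph V) (f g : V → ℝ) : ℝ :=
  (1 / 2) * ∑ x, ∑ y, (f x - f y) * (g x - g y) * G.weight x y

/-- The effective resistance between two (disjoint, nonempty) sets of vertices:
`R(A, B)⁻¹ = inf {𝓔(f, f) : f|_A = 0, f|_B = 1}`. -/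
def setResistance (G : WeightedGraph V) (A B : Set V) : ℝ :=
  (sInf {e : ℝ | ∃ f : V → ℝ,
    (∀ a ∈ A, f a = 0) ∧ (∀ b ∈ B, f b = 1) ∧ e = G.dirichletForm f f})⁻¹

open Classical in
/-- The resistance metric `R(x, y)` on the vertices. -/
def resistance (G : WeightedGraph V) (x y : V) : ℝ :=
  if x = y then 0 else G.setResistance {x} {y}

/-- The diameter `r(G) = max_{x, y} R(x, y)` in the resistance metric. -/
def resistanceDiam (G : WeightedGraph V) : ℝ := ⨆ p : V × V, G.resistance p.1 p.2

/-- The rescaled resistance metric `R̃(x, y) = r(G)⁻¹ R(x, y)`. -/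
def rescaledResistance (G : WeightedGraph V) (x y : V) : ℝ :=
  (G.resistanceDiam)⁻¹ * G.resistance x y

/-- The transition probabilities `P(x, y) = μ_{xy} / μ_x`. -/
def transProb (G : WeightedGraph V) (x y : V) : ℝ := G.weight x y / G.vertexWeight x

lemma vertexWeight_pos [Nontrivial V] (G : WeightedGraph V) (x : V) : 0 < G.vertexWeight x := by
  obtain ⟨y, hy⟩ := G.connected.preconnected.exists_adj_of_nontrivial x
  have hxy : 0 < G.weight x y := by
    rw [SimpleGraph.fromRel_adj] at hy
    rcases hy.2 with h | h
    · exact h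
    · rw [G.symm]; exact h
  exact Finset.sum_pos' (fun z _ => G.nonneg x z) ⟨y, Finset.mem_univ y, hxy⟩

lemma sum_transProb [Nontrivial V] (G : WeightedGraph V) (x : V) : ∑ y, G.transProb x y = 1 := by
  simp only [transProb]
  rw [← Finset.sum_div]
  exact div_self (G.vertexWeight_pos x).ne'

lemma transProb_nonneg (G : WeightedGraph V) (x y : V) : 0 ≤ G.transProb x y :=
  div_nonneg (G.nonneg x y) (Finset.sum_nonneg fun z _ => G.nonneg x z)

variable [MeasurableSpace V] [DiscreteMeasurableSpace V]

/-- The law of one step of the walk from `x`: it charges `y` with mass `P(x, y)`. -/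
def stepLaw (G : WeightedGraph V) (x : V) : Measure V :=
  ∑ y, ENNReal.ofReal (G.transProb x y) • Measure.dirac y

instance [Nontrivial V] (G : WeightedGraph V) (x : V) : IsProbabilityMeasure (G.stepLaw x) where
  measure_univ := by
    simp only [stepLaw, Measure.coe_finsetSum, Finset.sum_apply, Measure.smul_apply,
      measure_univ, smul_eq_mul, mul_one]
    rw [← ENNReal.ofReal_sum_of_nonneg fun y _ => G.transProb_nonneg x y, G.sum_transProb,
      ENNReal.ofReal_one]

/-- The Markov kernel giving the position at time `n + 1` from the positions up to time `n`:
it depends only on the position at time `n`. -/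
def stepKernel (G : WeightedGraph V) (n : ℕ) : Kernel (Π _ : Finset.Iic n, V) V :=
  (Kernel.ofFunOfCountable G.stepLaw).comap (fun h => h ⟨n, Finset.mem_Iic.2 le_rfl⟩)
    (measurable_pi_apply _)

instance [Nontrivial V] (G : WeightedGraph V) (n : ℕ) : IsMarkovKernel (G.stepKernel n) where
  isProbabilityMeasure h :=
    inferInstanceAs (IsProbabilityMeasure (G.stepLaw (h ⟨n, Finset.mem_Iic.2 le_rfl⟩)))

/-- The law `P_z` on path space `ℕ → V` of the discrete time simple random walk started at `z`. -/
def walkLaw [Nontrivial V] (G : WeightedGraph V) (z : V) : Measure (ℕ → V) :=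
  Kernel.trajMeasure (X := fun _ => V) (Measure.dirac z) G.stepKernel

/-- The local time `L_t(x) = μ_x⁻¹ ∑_{i < t} 1_{X_i = x}` of a path `X`. -/
def localTime (G : WeightedGraph V) (X : ℕ → V) (t : ℕ) (x : V) : ℝ :=
  1 / G.vertexWeight x * ∑ i ∈ Finset.range t, Set.indicator {x} (fun _ => (1 : ℝ)) (X i)

end

end WeightedGraph

/-! Everything rests on exponential supermartingales `F(X_t) exp(∑_{i<t} c(X_i))`, where `F ≥ 1` and
`e^c · PF ≤ F`. Freezing such a process when its exponent first reaches `k` and applying Markov's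
inequality gives `walkLaw_exists_le_sum`: the exponent ever reaches `k` with probability at most
`F(z) e^{-k}`, with no restriction on time.

To compare the local times at `x` and `y`, take `F` affine in the equilibrium potential between
them. Its Laplacian lives at the two poles, so the compensator `c` involves only the local times at
`x` and `y`. The exponent is `qR⁻¹ (L_t(x) - L_t(y)/(1-q))` for a free `q ∈ [0,1)`: the wanted
difference minus an error of second order in `q`, which is controlled while `L_t(y)/r ≤ L`.
Optimising in `q` up to constants gives a Gaussian bound (`IsPotential.walkLaw_localTime_sub_le`).
Exchanging the poles gives the other sign.

In (b), a positive difference of truncations forces the smaller local time below the level `L`, so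
the Gaussian bound applies directly. In (a), take the level `L = λ`, where the Gaussian becomes
`e^{-λ/8}`. Local times above `λ` up to time `T m r` are rare by a second supermartingale, built
from a bounded solution of the Poisson equation (`walkLaw_localTime_ge_le`). -/

namespace WeightedGraph

noncomputable section

/-! ### The walk and the maximal inequality. -/

section Walk

variable {V : Type u} [Fintype V] [MeasurableSpace V] [DiscreteMeasurableSpace V]

lemma lintegral_stepLaw (G : WeightedGraph V) (x : V) (f : V → ENNReal) :
    ∫⁻ v, f v ∂G.stepLaw x = ∑ v, ENNReal.ofReal (G.transProb x v) * f v := by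
  simp [stepLaw, lintegral_finsetSum_measure, lintegral_smul_measure]

/-- The path that follows a finite history and then stays at its last position. -/
def freezeHistory {n : ℕ} (h : Π _ : Finset.Iic n, V) : ℕ → V :=
  fun i => h ⟨min i n, Finset.mem_Iic.2 (min_le_right i n)⟩

/-- Such a function factors through finitely many coordinates of a finite state space, where every
function is measurable. -/
lemma measurable_of_forall_eq {α : Type*} [MeasurableSpace α] {n : ℕ} {f : (ℕ → V) → α}
    (hf : ∀ X Y : ℕ → V, (∀ i ≤ n, X i = Y i) → f X = f Y) : Measurable f := by
  have h : f = (fun h : (Π _ : Finset.Iic n, V) => f (freezeHistory h)) ∘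
      Preorder.frestrictLe (π := fun _ => V) n := by
    funext X
    exact hf _ _ fun i hi => by simp [freezeHistory, Preorder.frestrictLe, hi]
  rw [h]
  exact (measurable_of_finite _).comp (Preorder.measurable_frestrictLe n)

variable [Nontrivial V]

instance (G : WeightedGraph V) (z : V) : IsProbabilityMeasure (G.walkLaw z) :=
  inferInstanceAs (IsProbabilityMeasure
    (Kernel.trajMeasure (X := fun _ => V) (Measure.dirac z) G.stepKernel))

/-- Markov property: integrating out the position at time `n + 1`. -/
lemma lintegral_walkLaw_succ (G : WeightedGraph V) (z : V) (n : ℕ)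
    (f : (ℕ → V) → V → ENNReal)
    (hf : ∀ X Y : ℕ → V, (∀ i ≤ n, X i = Y i) → f X = f Y) :
    ∫⁻ X, f X (X (n + 1)) ∂G.walkLaw z =
      ∫⁻ X, ∑ v, ENNReal.ofReal (G.transProb (X n) v) * f X v ∂G.walkLaw z := by
  -- The joint law of the history up to `n` and the next position is the history law composed with
  -- the step kernel. Freezing a history turns it back into a path on which `f` can be evaluated.
  have key := Kernel.map_frestrictLe_trajMeasure_compProd_eq_map_trajMeasure
    (X := fun _ => V) (μ₀ := Measure.dirac z) (κ := G.stepKernel) (a := n)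
  have hfz : ∀ X : ℕ → V, f (freezeHistory (Preorder.frestrictLe (π := fun _ => V) n X)) = f X :=
    fun X => hf _ _ fun i hi => by simp [freezeHistory, Preorder.frestrictLe, hi]
  let φ : (Π _ : Finset.Iic n, V) × V → ENNReal := fun p => f (freezeHistory p.1) p.2
  have hφ : Measurable φ := measurable_of_finite _
  have h2 : ∫⁻ p, φ p ∂((G.walkLaw z).map (Preorder.frestrictLe n) ⊗ₘ G.stepKernel n) =
      ∫⁻ p, φ p ∂(G.walkLaw z).map (fun X => (Preorder.frestrictLe n X, X (n + 1))) :=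
    congrArg (fun m => ∫⁻ p, φ p ∂m) key
  rw [Measure.lintegral_compProd hφ, lintegral_map hφ (by fun_prop),
    lintegral_map (measurable_of_finite _) (by fun_prop)] at h2
  simp only [φ, hfz] at h2
  refine h2.symm.trans (lintegral_congr fun X => ?_)
  exact lintegral_stepLaw G (X n) (f X)

lemma lintegral_trajMeasure_zero {X : ℕ → Type*} [∀ n, MeasurableSpace (X n)]
    (μ₀ : Measure (X 0)) (κ : (n : ℕ) → Kernel (Π i : Finset.Iic n, X i) (X (n + 1)))
    [∀ n, IsMarkovKernel (κ n)] {f : X 0 → ENNReal} (hf : Measurable f) :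
    ∫⁻ x, f (x 0) ∂Kernel.trajMeasure μ₀ κ = ∫⁻ v, f v ∂μ₀ := by
  obtain ⟨e, he, hev, h0⟩ : ∃ e : X 0 → (Π i : Finset.Iic 0, X i), Measurable e ∧
      (∀ v, e v ⟨0, Finset.mem_Iic.2 le_rfl⟩ = v) ∧
      (Kernel.trajMeasure μ₀ κ).map (Preorder.frestrictLe (π := X) 0) = μ₀.map e := by
    refine ⟨(MeasurableEquiv.piUnique (fun i : Finset.Iic 0 => X i)).symm,
      MeasurableEquiv.measurable _, fun _ => rfl, ?_⟩
    rw [Kernel.trajMeasure, Measure.map_comp _ _ (by fun_prop), Kernel.traj_map_frestrictLe,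
      Kernel.partialTraj_self, Measure.id_comp]
    rfl
  have hg : Measurable fun h : (Π i : Finset.Iic 0, X i) => f (h ⟨0, Finset.mem_Iic.2 le_rfl⟩) :=
    hf.comp (measurable_pi_apply (⟨0, Finset.mem_Iic.2 le_rfl⟩ : Finset.Iic 0))
  have h1 := lintegral_map (μ := Kernel.trajMeasure μ₀ κ) hg (Preorder.measurable_frestrictLe 0)
  rw [h0, lintegral_map hg he] at h1
  simp only [hev] at h1
  exact h1.symm

lemma lintegral_walkLaw_zero (G : WeightedGraph V) (z : V) (f : V → ENNReal) :
    ∫⁻ X, f (X 0) ∂G.walkLaw z = f z :=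
  (lintegral_trajMeasure_zero (X := fun _ => V) (Measure.dirac z) G.stepKernel
    (measurable_of_finite f)).trans (lintegral_dirac _ _)

/-- Maximal inequality for the exponential supermartingale `F(X_t) exp (∑_{i < t} c(X_i))`. -/
theorem walkLaw_exists_le_sum (G : WeightedGraph V) (z : V) (F c : V → ℝ) (hF : ∀ v, 1 ≤ F v)
    (hc : ∀ v, Real.exp (c v) * ∑ w, G.transProb v w * F w ≤ F v) (k : ℝ) :
    (G.walkLaw z).real {X : ℕ → V | ∃ t : ℕ, k ≤ ∑ i ∈ Finset.range t, c (X i)} ≤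
      F z * Real.exp (-k) := by
  classical
  let S : ℕ → (ℕ → V) → ℝ := fun t X => ∑ i ∈ Finset.range t, c (X i)
  -- The supermartingale, replaced by the constant `e^k` once the sum has reached `k`. The current
  -- position is a separate argument because the sum up to `n` uses only the positions before `n`.
  let Z : ℕ → (ℕ → V) → V → ENNReal := fun n X v =>
    if ∃ t ≤ n, k ≤ S t X then ENNReal.ofReal (Real.exp k)
      else ENNReal.ofReal (F v * Real.exp (S n X))
  have hFpos : ∀ v, 0 < F v := fun v => zero_lt_one.trans_le (hF v)
  have hS : ∀ n (X Y : ℕ → V), (∀ i < n, X i = Y i) → ∀ t ≤ n, S t X = S t Y := by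
    intro n X Y h t ht
    refine Finset.sum_congr rfl fun i hi => ?_
    rw [h i ((Finset.mem_range.1 hi).trans_le ht)]
  have hZ : ∀ n (X Y : ℕ → V), (∀ i < n, X i = Y i) → Z n X = Z n Y := by
    intro n X Y h
    have h1 : (∃ t ≤ n, k ≤ S t X) ↔ ∃ t ≤ n, k ≤ S t Y :=
      exists_congr fun t => and_congr_right fun ht => by rw [hS n X Y h t ht]
    funext v
    simp only [Z, h1, hS n X Y h n le_rfl]
  have hstep : ∀ n (X : ℕ → V),
      ∑ v, ENNReal.ofReal (G.transProb (X n) v) * Z (n + 1) X v ≤ Z n X (X n) := by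
    intro n X
    by_cases h : ∃ t ≤ n, k ≤ S t X
    · have h' : ∃ t ≤ n + 1, k ≤ S t X := h.imp fun t ht => ⟨ht.1.trans n.le_succ, ht.2⟩
      simp only [Z, if_pos h, if_pos h']
      rw [← Finset.sum_mul, ← ENNReal.ofReal_sum_of_nonneg fun y _ => G.transProb_nonneg _ y,
        G.sum_transProb, ENNReal.ofReal_one, one_mul]
    · have hle : ∀ v, Z (n + 1) X v ≤ ENNReal.ofReal (F v * Real.exp (S (n + 1) X)) := by
        intro v
        by_cases h' : ∃ t ≤ n + 1, k ≤ S t X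
        · simp only [Z, if_pos h']
          obtain ⟨t, ht, hk⟩ := h'
          -- The level is reached exactly now, so the sum is at least `k`, and `F ≥ 1` makes the
          -- frozen value `e^k` no larger than the running one.
          have : t = n + 1 := by
            by_contra hne
            exact h ⟨t, by omega, hk⟩
          subst this
          refine ENNReal.ofReal_le_ofReal ((Real.exp_le_exp.2 hk).trans ?_)
          exact le_mul_of_one_le_left (Real.exp_pos _).le (hF v)
        · simp only [Z, if_neg h', le_refl]
      calc ∑ v, ENNReal.ofReal (G.transProb (X n) v) * Z (n + 1) X v
          ≤ ∑ v, ENNReal.ofReal (G.transProb (X n) v) *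
              ENNReal.ofReal (F v * Real.exp (S (n + 1) X)) := by
            gcongr with v
            exact hle v
        _ = ENNReal.ofReal (∑ v, G.transProb (X n) v * (F v * Real.exp (S (n + 1) X))) := by
            rw [ENNReal.ofReal_sum_of_nonneg fun v _ => mul_nonneg (G.transProb_nonneg _ v)
              (mul_nonneg (hFpos v).le (Real.exp_pos _).le)]
            exact Finset.sum_congr rfl fun v _ =>
              (ENNReal.ofReal_mul (G.transProb_nonneg _ v)).symm
        _ ≤ Z n X (X n) := by
            simp only [Z, if_neg h]
            refine ENNReal.ofReal_le_ofReal ?_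
            have : S (n + 1) X = S n X + c (X n) := Finset.sum_range_succ _ _
            rw [this, Real.exp_add]
            calc ∑ v, G.transProb (X n) v * (F v * (Real.exp (S n X) * Real.exp (c (X n))))
                = (Real.exp (c (X n)) * ∑ v, G.transProb (X n) v * F v) * Real.exp (S n X) := by
                  rw [Finset.mul_sum, Finset.sum_mul]
                  exact Finset.sum_congr rfl fun v _ => by ring
              _ ≤ _ := mul_le_mul_of_nonneg_right (hc _) (Real.exp_pos _).le
  have hint : ∀ n, ∫⁻ X, Z n X (X n) ∂G.walkLaw z ≤ ENNReal.ofReal (F z) := by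
    intro n
    induction n with
    | zero =>
      refine le_trans (lintegral_mono fun X => ?_)
        (lintegral_walkLaw_zero G z fun v => ENNReal.ofReal (F v)).le
      by_cases h : k ≤ 0
      · simp only [Z, S, nonpos_iff_eq_zero, exists_eq_left, Finset.range_zero, Finset.sum_empty,
          h, if_true]
        exact ENNReal.ofReal_le_ofReal ((Real.exp_le_one_iff.2 h).trans (hF _))
      · simp [Z, S, h]
    | succ n ih =>
      refine le_trans ?_ ih
      rw [lintegral_walkLaw_succ G z n (Z (n + 1))
        fun X Y h => hZ _ X Y fun i hi => h i (Nat.lt_succ_iff.1 hi)]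
      exact lintegral_mono fun X => hstep n X
  have hfin : ∀ n, G.walkLaw z {X | ∃ t ≤ n, k ≤ S t X} ≤
      ENNReal.ofReal (F z * Real.exp (-k)) := by
    intro n
    have hmeas : Measurable fun X : ℕ → V => Z n X (X n) :=
      measurable_of_forall_eq (n := n) fun X Y h => by
        rw [hZ n X Y fun i hi => h i hi.le, h n le_rfl]
    have hk0 : ENNReal.ofReal (Real.exp k) ≠ 0 := by simpa using Real.exp_pos k
    calc G.walkLaw z {X | ∃ t ≤ n, k ≤ S t X}
        ≤ G.walkLaw z {X | ENNReal.ofReal (Real.exp k) ≤ Z n X (X n)} := by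
          refine measure_mono fun X hX => ?_
          have hX' : ∃ t ≤ n, k ≤ S t X := hX
          simp only [Z, Set.mem_ofPred_eq, if_pos hX', le_refl]
      _ ≤ _ := meas_ge_le_lintegral_div hmeas.aemeasurable hk0 ENNReal.ofReal_ne_top
      _ ≤ ENNReal.ofReal (F z) / ENNReal.ofReal (Real.exp k) := by gcongr; exact hint n
      _ = _ := by
          rw [← ENNReal.ofReal_div_of_pos (Real.exp_pos k), Real.exp_neg, div_eq_mul_inv]
  have hunion : {X : ℕ → V | ∃ t : ℕ, k ≤ S t X} = ⋃ n, {X | ∃ t ≤ n, k ≤ S t X} := by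
    ext X
    simp only [Set.mem_ofPred_eq, Set.mem_iUnion]
    exact ⟨fun ⟨t, ht⟩ => ⟨t, t, le_rfl, ht⟩, fun ⟨_, t, _, ht⟩ => ⟨t, ht⟩⟩
  -- The finite-horizon bound does not depend on `n`, so it survives the increasing union.
  have hmono : Monotone fun n => {X : ℕ → V | ∃ t ≤ n, k ≤ S t X} :=
    fun m n hmn X ⟨t, ht, h⟩ => ⟨t, ht.trans hmn, h⟩
  change (G.walkLaw z).real {X : ℕ → V | ∃ t : ℕ, k ≤ S t X} ≤ _
  refine ENNReal.toReal_le_of_le_ofReal (mul_nonneg (hFpos z).le (Real.exp_pos _).le) ?_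
  rw [hunion, hmono.measure_iUnion]
  exact iSup_le hfin

end Walk

/-! ### Equilibrium potentials, resistance and the Poisson equation. -/

section Potential

variable {V : Type u} [Fintype V]

/-- The (unnormalised, positive) Laplacian `∑_w (f(v) - f(w)) μ_{vw}`. -/
def laplacian (G : WeightedGraph V) (f : V → ℝ) (v : V) : ℝ := ∑ w, (f v - f w) * G.weight v w

/-- Summation by parts: by symmetry of the weights the two halves of the double sum agree. -/
lemma dirichletForm_eq_sum_mul_laplacian (G : WeightedGraph V) (f g : V → ℝ) :
    G.dirichletForm f g = ∑ v, f v * G.laplacian g v := by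
  have h1 : ∑ x, ∑ y, f y * (g x - g y) * G.weight x y =
      - ∑ x, ∑ y, f x * (g x - g y) * G.weight x y := by
    rw [Finset.sum_comm, ← Finset.sum_neg_distrib]
    refine Finset.sum_congr rfl fun x _ => ?_
    rw [← Finset.sum_neg_distrib]
    refine Finset.sum_congr rfl fun y _ => ?_
    rw [G.symm y x]; ring
  have h2 : ∑ x, ∑ y, (f x - f y) * (g x - g y) * G.weight x y =
      ∑ x, ∑ y, f x * (g x - g y) * G.weight x y -
        ∑ x, ∑ y, f y * (g x - g y) * G.weight x y := by
    simp only [sub_mul, Finset.sum_sub_distrib]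
  rw [dirichletForm, h2, h1]
  simp only [laplacian, Finset.mul_sum]
  simp only [← mul_assoc]
  ring

lemma sum_laplacian (G : WeightedGraph V) (g : V → ℝ) : ∑ v, G.laplacian g v = 0 := by
  have h := G.dirichletForm_eq_sum_mul_laplacian (fun _ => 1) g
  simp only [one_mul] at h
  rw [← h]
  simp [dirichletForm]

lemma dirichletForm_self_nonneg (G : WeightedGraph V) (f : V → ℝ) : 0 ≤ G.dirichletForm f f :=
  mul_nonneg (by norm_num) <| Finset.sum_nonneg fun x _ => Finset.sum_nonneg fun y _ =>
    mul_nonneg (mul_self_nonneg _) (G.nonneg x y)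

lemma dirichletForm_add_mul_self (G : WeightedGraph V) (g h : V → ℝ) (t : ℝ) :
    G.dirichletForm (fun v => g v + t * h v) (fun v => g v + t * h v) =
      G.dirichletForm g g + 2 * t * G.dirichletForm h g + t ^ 2 * G.dirichletForm h h := by
  simp only [dirichletForm, Finset.mul_sum, ← Finset.sum_add_distrib]
  exact Finset.sum_congr rfl fun x _ => Finset.sum_congr rfl fun y _ => by ring

/-- Zero energy forces `f` to be constant along edges, hence along a walk from `x` to `y`. -/
lemma dirichletForm_self_pos (G : WeightedGraph V) {f : V → ℝ} {x y : V} (hxy : f x ≠ f y) :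
    0 < G.dirichletForm f f := by
  refine (G.dirichletForm_self_nonneg f).lt_of_ne' fun h0 => hxy ?_
  have hterm : ∀ a b, (f a - f b) * (f a - f b) * G.weight a b = 0 := by
    have hnn : ∀ a b, 0 ≤ (f a - f b) * (f a - f b) * G.weight a b :=
      fun a b => mul_nonneg (mul_self_nonneg _) (G.nonneg a b)
    have hs : ∑ a, ∑ b, (f a - f b) * (f a - f b) * G.weight a b = 0 := by
      simpa [dirichletForm] using h0
    intro a b
    have ha := (Finset.sum_eq_zero_iff_of_nonneg
      fun a _ => Finset.sum_nonneg fun b _ => hnn a b).1 hs a (Finset.mem_univ a)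
    exact (Finset.sum_eq_zero_iff_of_nonneg fun b _ => hnn a b).1 ha b (Finset.mem_univ b)
  have hpos : ∀ a b, 0 < G.weight a b → f a = f b := fun a b hab => by
    have := hterm a b
    simpa [hab.ne', sub_eq_zero] using this
  obtain ⟨p⟩ := G.connected.preconnected x y
  clear hxy
  induction p with
  | nil => rfl
  | cons hadj _ ih =>
    rw [SimpleGraph.fromRel_adj] at hadj
    exact (hadj.2.elim (hpos _ _) fun h => (hpos _ _ h).symm).trans ih

lemma dirichletForm_projIcc_le (G : WeightedGraph V) (f : V → ℝ) :
    G.dirichletForm (fun v => (Set.projIcc (0 : ℝ) 1 zero_le_one (f v) : ℝ))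
      (fun v => (Set.projIcc (0 : ℝ) 1 zero_le_one (f v) : ℝ)) ≤ G.dirichletForm f f := by
  refine mul_le_mul_of_nonneg_left ?_ (by norm_num)
  refine Finset.sum_le_sum fun x _ => Finset.sum_le_sum fun y _ =>
    mul_le_mul_of_nonneg_right ?_ (G.nonneg x y)
  rw [← abs_mul_abs_self, ← abs_mul_abs_self (f x - f y)]
  have := Set.abs_projIcc_sub_projIcc (c := f x) (d := f y) (zero_le_one (α := ℝ))
  exact mul_self_le_mul_self (abs_nonneg _) this

/-- Clamping values to `[0, 1]` does not raise the energy, so minimising over the compact cube, with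
the boundary values fixed, also minimises over all functions. -/
lemma exists_isLeast_dirichletForm (G : WeightedGraph V) {x y : V} (hxy : x ≠ y) :
    ∃ g : V → ℝ, (∀ v, g v ∈ Set.Icc (0 : ℝ) 1) ∧ g x = 0 ∧ g y = 1 ∧
      ∀ f : V → ℝ, f x = 0 → f y = 1 → G.dirichletForm g g ≤ G.dirichletForm f f := by
  classical
  let K : Set (V → ℝ) := (Set.univ.pi fun _ => Set.Icc (0 : ℝ) 1) ∩ ({f | f x = 0} ∩ {f | f y = 1})
  have hK : IsCompact K := (isCompact_univ_pi fun _ => isCompact_Icc).inter_right <|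
    (isClosed_eq (continuous_apply x) continuous_const).inter
      (isClosed_eq (continuous_apply y) continuous_const)
  have hne : K.Nonempty := by
    refine ⟨Pi.single y 1, fun v _ => ?_, ?_, ?_⟩
    · by_cases h : v = y
      · subst h; simp
      · simp [h]
    · simp [hxy]
    · simp
  have hcont : Continuous fun f : V → ℝ => G.dirichletForm f f := by
    unfold dirichletForm
    fun_prop
  obtain ⟨g, ⟨hg1, hg2, hg3⟩, hmin⟩ := hK.exists_isMinOn hne hcont.continuousOn
  refine ⟨g, fun v => hg1 v (Set.mem_univ v), hg2, hg3, fun f hfx hfy => ?_⟩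
  refine le_trans (hmin (a := fun v => (Set.projIcc (0 : ℝ) 1 zero_le_one (f v) : ℝ)) ?_)
    (G.dirichletForm_projIcc_le f)
  refine ⟨fun v _ => Subtype.prop _, ?_, ?_⟩
  · simp [hfx]
  · simp [hfy]

/-- `g` is the equilibrium potential which vanishes at `x`, equals `1` at `y`, and carries a
current `c` from `y` to `x`. -/
structure IsPotential (G : WeightedGraph V) (g : V → ℝ) (x y : V) (c : ℝ) : Prop where
  nonneg : ∀ v, 0 ≤ g v
  le_one : ∀ v, g v ≤ 1
  left : g x = 0
  right : g y = 1
  laplacian_left : G.laplacian g x = -c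
  laplacian_right : G.laplacian g y = c
  harmonic : ∀ v, v ≠ x → v ≠ y → G.laplacian g v = 0

/-- Exchanging the poles reverses the current. One potential thus serves both signs of the local
time difference. -/
lemma IsPotential.one_sub {G : WeightedGraph V} {g : V → ℝ} {x y : V} {c : ℝ}
    (h : G.IsPotential g x y c) : G.IsPotential (fun v => 1 - g v) y x c := by
  have hl : ∀ v, G.laplacian (fun v => 1 - g v) v = -G.laplacian g v := fun v => by
    simp only [laplacian, ← Finset.sum_neg_distrib]
    exact Finset.sum_congr rfl fun w _ => by ring
  refine ⟨fun v => sub_nonneg.2 (h.le_one v), fun v => sub_le_self _ (h.nonneg v), ?_, ?_, ?_, ?_,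
    fun v hy hx => ?_⟩
  · simp [h.right]
  · simp [h.left]
  · rw [hl, h.laplacian_right]
  · rw [hl, h.laplacian_left, neg_neg]
  · rw [hl, h.harmonic v hx hy, neg_zero]

/-- The energy minimiser is harmonic off the poles by first variation. Summation by parts identifies
the current at `y` with the minimal energy `R⁻¹`, and the current at `x` is opposite since a
Laplacian sums to zero. -/
theorem exists_isPotential (G : WeightedGraph V) {x y : V} (hxy : x ≠ y) :
    0 < G.resistance x y ∧ ∃ g : V → ℝ, G.IsPotential g x y (G.resistance x y)⁻¹ := by
  classical
  obtain ⟨g, hg, hgx, hgy, hmin⟩ := G.exists_isLeast_dirichletForm hxy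
  have hR : G.resistance x y = (G.dirichletForm g g)⁻¹ := by
    rw [resistance, if_neg hxy, setResistance]
    congr 1
    refine IsLeast.csInf_eq ⟨⟨g, by simpa using hgx, by simpa using hgy, rfl⟩, ?_⟩
    rintro e ⟨f, hfx, hfy, rfl⟩
    exact hmin f (hfx x rfl) (hfy y rfl)
  have hpos : 0 < G.dirichletForm g g :=
    G.dirichletForm_self_pos (x := x) (y := y) (by rw [hgx, hgy]; exact zero_ne_one)
  have hharm : ∀ v, v ≠ x → v ≠ y → G.laplacian g v = 0 := by
    intro v hvx hvy
    have hE : G.dirichletForm (Pi.single v 1) g = G.laplacian g v := by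
      rw [dirichletForm_eq_sum_mul_laplacian, Finset.sum_eq_single v]
      · simp
      · intro w _ hw; simp [hw]
      · simp
    set D := G.dirichletForm (Pi.single v 1) (Pi.single v 1) with hD
    have hD0 : 0 ≤ D := G.dirichletForm_self_nonneg _
    set l := G.laplacian g v
    have hq : ∀ t : ℝ, 0 ≤ 2 * t * l + t ^ 2 * D := by
      intro t
      have h1 := hmin (fun w => g w + t * (Pi.single v 1 : V → ℝ) w)
        (by simp [hgx, hvx.symm]) (by simp [hgy, hvy.symm])
      rw [dirichletForm_add_mul_self, hE, ← hD] at h1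
      linarith
    -- A near-minimiser of `2tl + t²D`. Using `D + 1` avoids dividing by a possibly zero `D`, and
    -- the value is still negative unless `l = 0`.
    have h2 := hq (-l / (D + 1))
    have hD1 : 0 < D + 1 := by linarith
    have h3 : 2 * (-l / (D + 1)) * l + (-l / (D + 1)) ^ 2 * D =
        -(l ^ 2 * (D + 2)) / (D + 1) ^ 2 := by field_simp; ring
    rw [h3, le_div_iff₀ (by positivity)] at h2
    have : l ^ 2 = 0 := by nlinarith [sq_nonneg l]
    exact pow_eq_zero_iff two_ne_zero |>.1 this
  have hlr : G.laplacian g y = G.dirichletForm g g := by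
    rw [dirichletForm_eq_sum_mul_laplacian, Finset.sum_eq_single y]
    · rw [hgy, one_mul]
    · intro v _ hv
      by_cases hvx : v = x
      · rw [hvx, hgx, zero_mul]
      · rw [hharm v hvx hv, mul_zero]
    · simp
  have hll : G.laplacian g x = -G.dirichletForm g g := by
    have h := G.sum_laplacian g
    rw [← Finset.add_sum_erase _ _ (Finset.mem_univ x), ← Finset.add_sum_erase _ _
      (Finset.mem_erase.2 ⟨hxy.symm, Finset.mem_univ y⟩), Finset.sum_eq_zero, hlr] at h
    · linarith
    · intro v hv
      simp only [Finset.mem_erase, Finset.mem_univ, and_true] at hv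
      exact hharm v hv.2 hv.1
  rw [hR, inv_inv]
  exact ⟨inv_pos.2 hpos, g, fun v => (hg v).1, fun v => (hg v).2, hgx, hgy, hll, hlr, hharm⟩

lemma resistance_le_resistanceDiam (G : WeightedGraph V) (x y : V) :
    G.resistance x y ≤ G.resistanceDiam :=
  le_ciSup (f := fun p : V × V => G.resistance p.1 p.2) (Set.finite_range _).bddAbove (x, y)

lemma resistanceDiam_pos [Nontrivial V] (G : WeightedGraph V) : 0 < G.resistanceDiam := by
  obtain ⟨x, y, hxy⟩ := exists_pair_ne V
  exact (G.exists_isPotential hxy).1.trans_le (G.resistance_le_resistanceDiam x y)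

lemma totalMass_pos [Nontrivial V] (G : WeightedGraph V) : 0 < G.totalMass :=
  Finset.sum_pos (fun x _ => G.vertexWeight_pos x) Finset.univ_nonempty

lemma sum_transProb_mul [Nontrivial V] (G : WeightedGraph V) (f : V → ℝ) (v : V) :
    ∑ w, G.transProb v w * f w = f v - G.laplacian f v / G.vertexWeight v := by
  have h := (G.vertexWeight_pos v).ne'
  rw [eq_sub_iff_add_eq, laplacian, Finset.sum_div, ← Finset.sum_add_distrib]
  calc ∑ w, (G.transProb v w * f w + (f v - f w) * G.weight v w / G.vertexWeight v)
      = ∑ w, G.transProb v w * f v :=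
        Finset.sum_congr rfl fun w _ => by rw [transProb]; field_simp; ring
    _ = f v := by rw [← Finset.sum_mul, G.sum_transProb, one_mul]

lemma IsPotential.le_vertexWeight {G : WeightedGraph V} {g : V → ℝ} {x y : V} {c : ℝ}
    (h : G.IsPotential g x y c) : c ≤ G.vertexWeight y := by
  rw [← h.laplacian_right, laplacian, vertexWeight]
  refine Finset.sum_le_sum fun w _ => mul_le_of_le_one_left (G.nonneg y w) ?_
  rw [h.right]
  linarith [h.nonneg w]

/-- The current `R⁻¹` out of `y` cannot exceed `μ_y`, as potential differences are at most `1`. -/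
lemma one_le_vertexWeight_mul_resistanceDiam [Nontrivial V] (G : WeightedGraph V) (y : V) :
    1 ≤ G.vertexWeight y * G.resistanceDiam := by
  obtain ⟨x, hx⟩ := exists_ne y
  obtain ⟨hR, g, hg⟩ := G.exists_isPotential hx
  have h1 := hg.le_vertexWeight
  have h2 := G.resistance_le_resistanceDiam x y
  have h3 := (inv_le_iff_one_le_mul₀ hR).1 h1
  exact h3.trans (mul_le_mul_of_nonneg_left h2 (G.vertexWeight_pos y).le)

open Classical in
/-- Solution of the Poisson equation `Δf = 1_y - μ / m(G)`, with values in `[0, r(G)]`. -/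
theorem exists_poisson [Nontrivial V] (G : WeightedGraph V) (y : V) :
    ∃ f : V → ℝ, (∀ v, 0 ≤ f v) ∧ (∀ v, f v ≤ G.resistanceDiam) ∧
      ∀ v, G.laplacian f v = (if v = y then 1 else 0) - G.vertexWeight v / G.totalMass := by
  -- Multiplying the potential by the resistance gives unit current from `y` to `w`. Averaging over
  -- `w` with weights `μ_w / m(G)` then spreads the sink over the whole graph and keeps the values
  -- in `[0, r(G)]`.
  have hk : ∀ w, ∃ k : V → ℝ, (∀ v, 0 ≤ k v) ∧ (∀ v, k v ≤ G.resistanceDiam) ∧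
      ∀ v, G.laplacian k v = (if v = y then 1 else 0) - (if v = w then 1 else 0) := by
    intro w
    by_cases hwy : w = y
    · exact ⟨fun _ => 0, fun _ => le_rfl, fun _ => G.resistanceDiam_pos.le,
        fun v => by simp [hwy, laplacian]⟩
    · obtain ⟨hR, g, hg⟩ := G.exists_isPotential hwy
      refine ⟨fun v => G.resistance w y * g v, fun v => mul_nonneg hR.le (hg.nonneg v),
        fun v => (mul_le_of_le_one_right hR.le (hg.le_one v)).trans
          (G.resistance_le_resistanceDiam w y), fun v => ?_⟩
      have hl : G.laplacian (fun v => G.resistance w y * g v) v =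
          G.resistance w y * G.laplacian g v := by
        simp only [laplacian, Finset.mul_sum]
        exact Finset.sum_congr rfl fun u _ => by ring
      rw [hl]
      by_cases hvy : v = y
      · subst hvy
        rw [hg.laplacian_right, mul_inv_cancel₀ hR.ne', if_pos rfl, if_neg (Ne.symm hwy), sub_zero]
      · by_cases hvw : v = w
        · subst hvw
          rw [hg.laplacian_left, mul_neg, mul_inv_cancel₀ hR.ne', if_pos rfl, if_neg hvy, zero_sub]
        · rw [hg.harmonic v hvw hvy, if_neg hvy, if_neg hvw, mul_zero, sub_zero]
  choose k hk0 hkr hkl using hk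
  have hm := G.totalMass_pos
  have hp : ∀ w, 0 ≤ G.vertexWeight w / G.totalMass :=
    fun w => div_nonneg (G.vertexWeight_pos w).le hm.le
  have hp1 : ∑ w, G.vertexWeight w / G.totalMass = 1 := by
    rw [← Finset.sum_div]; exact div_self hm.ne'
  refine ⟨fun v => ∑ w, G.vertexWeight w / G.totalMass * k w v,
    fun v => Finset.sum_nonneg fun w _ => mul_nonneg (hp w) (hk0 w v), fun v => ?_, fun v => ?_⟩
  · calc ∑ w, G.vertexWeight w / G.totalMass * k w v
        ≤ ∑ w, G.vertexWeight w / G.totalMass * G.resistanceDiam :=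
          Finset.sum_le_sum fun w _ => mul_le_mul_of_nonneg_left (hkr w v) (hp w)
      _ = G.resistanceDiam := by rw [← Finset.sum_mul, hp1, one_mul]
  · have hl : G.laplacian (fun v => ∑ w, G.vertexWeight w / G.totalMass * k w v) v =
        ∑ w, G.vertexWeight w / G.totalMass * G.laplacian (k w) v := by
      simp only [laplacian, ← Finset.sum_sub_distrib, Finset.sum_mul, Finset.mul_sum]
      rw [Finset.sum_comm]
      exact Finset.sum_congr rfl fun w _ => Finset.sum_congr rfl fun u _ => by ring
    rw [hl]
    simp only [hkl, mul_sub, Finset.sum_sub_distrib, mul_ite, mul_one, mul_zero,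
      Finset.sum_ite_eq, Finset.mem_univ, if_true]
    congr 1
    split_ifs
    · exact hp1
    · exact Finset.sum_const_zero

end Potential

/-! ### Exponential bounds for local times. -/

section LocalTime

variable {V : Type u} [Fintype V]

lemma localTime_nonneg (G : WeightedGraph V) (X : ℕ → V) (t : ℕ) (x : V) :
    0 ≤ G.localTime X t x :=
  mul_nonneg (one_div_nonneg.2 (Finset.sum_nonneg fun y _ => G.nonneg x y)) <|
    Finset.sum_nonneg fun _ _ => Set.indicator_nonneg (fun _ _ => zero_le_one) _

lemma rescaledResistance_le_one [Nontrivial V] (G : WeightedGraph V) (x y : V) :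
    G.rescaledResistance x y ≤ 1 := by
  rw [rescaledResistance, inv_mul_le_iff₀ G.resistanceDiam_pos, mul_one]
  exact G.resistance_le_resistanceDiam x y

variable [MeasurableSpace V] [DiscreteMeasurableSpace V] [Nontrivial V]

/-- Exponential bound for the local times at the two poles of a potential. -/
theorem IsPotential.walkLaw_localTime_combination_le {G : WeightedGraph V} {g : V → ℝ} {x y : V} {c : ℝ}
    (h : G.IsPotential g y x c) (z : V) {q : ℝ} (hq0 : 0 ≤ q) (hq1 : q < 1) (k : ℝ) :
    (G.walkLaw z).real {X : ℕ → V | ∃ t : ℕ,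
        k ≤ q * c * G.localTime X t x - q * c / (1 - q) * G.localTime X t y} ≤
      (1 - q)⁻¹ * Real.exp (-k) := by
  classical
  have hq : 0 < 1 - q := sub_pos.2 hq1
  have hxy : x ≠ y := fun e => by
    have h1 := h.left
    rw [← e, h.right] at h1
    exact one_ne_zero h1
  have hqq : 0 ≤ q / (1 - q) := div_nonneg hq0 hq.le
  -- Normalised so that `F = 1` at `y` and `F = 1/(1-q)` at `x`. Then `PF/F` is `1 - qc/μ_x` at `x`,
  -- `1 + qc/((1-q)μ_y)` at `y` and `1` elsewhere. `w` replaces minus the logarithm of this ratio by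
  -- its linear bound.
  let F : V → ℝ := fun v => 1 + q / (1 - q) * g v
  let w : V → ℝ := fun v => q * c * (1 / G.vertexWeight x * Set.indicator {x} (fun _ => (1 : ℝ)) v)
    - q * c / (1 - q) * (1 / G.vertexWeight y * Set.indicator {y} (fun _ => (1 : ℝ)) v)
  have hF : ∀ v, 1 ≤ F v := fun v => le_add_of_nonneg_right (mul_nonneg hqq (h.nonneg v))
  have hPF : ∀ v, ∑ u, G.transProb v u * F u =
      F v - q / (1 - q) * G.laplacian g v / G.vertexWeight v := by
    intro v
    have h1 := G.sum_transProb_mul g v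
    have h2 : ∑ u, G.transProb v u * F u =
        ∑ u, G.transProb v u + q / (1 - q) * ∑ u, G.transProb v u * g u := by
      rw [Finset.mul_sum, ← Finset.sum_add_distrib]
      exact Finset.sum_congr rfl fun u _ => by simp only [F]; ring
    rw [h2, h1, G.sum_transProb]
    simp only [F]
    ring
  have hw : ∀ v, Real.exp (w v) * ∑ u, G.transProb v u * F u ≤ F v := by
    intro v
    rw [hPF]
    by_cases hvx : v = x
    · subst hvx
      have hμ := G.vertexWeight_pos v
      have hwv : w v = q * c / G.vertexWeight v := by
        simp [w, hxy, div_eq_mul_inv]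
      have hFv : F v = (1 - q)⁻¹ := by
        simp only [F, h.right]
        field_simp
        ring
      rw [hwv, hFv, h.laplacian_right]
      set s := q * c / G.vertexWeight v with hs
      have : (1 - q)⁻¹ - q / (1 - q) * c / G.vertexWeight v = (1 - q)⁻¹ * (1 - s) := by
        rw [hs]; field_simp
      rw [this, mul_left_comm]
      refine mul_le_of_le_one_right (inv_pos.2 hq).le ?_
      calc Real.exp s * (1 - s) ≤ Real.exp s * Real.exp (-s) :=
            mul_le_mul_of_nonneg_left (Real.one_sub_le_exp_neg s) (Real.exp_pos _).le
        _ = 1 := by rw [← Real.exp_add, add_neg_cancel, Real.exp_zero]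
    · by_cases hvy : v = y
      · subst hvy
        have hμ := G.vertexWeight_pos v
        have hwv : w v = -(q * c / (1 - q) / G.vertexWeight v) := by
          simp [w, hvx, div_eq_mul_inv]
        have hFv : F v = 1 := by simp [F, h.left]
        rw [hwv, hFv, h.laplacian_left]
        set s := q * c / (1 - q) / G.vertexWeight v with hs
        have : 1 - q / (1 - q) * -c / G.vertexWeight v = 1 + s := by
          rw [hs]; ring
        rw [this]
        calc Real.exp (-s) * (1 + s) ≤ Real.exp (-s) * Real.exp s :=
              mul_le_mul_of_nonneg_left (by linarith [Real.add_one_le_exp s]) (Real.exp_pos _).le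
          _ = 1 := by rw [← Real.exp_add, neg_add_cancel, Real.exp_zero]
      · have hwv : w v = 0 := by simp [w, hvx, hvy]
        rw [hwv, h.harmonic v hvy hvx]
        simp
  have hsum : ∀ (X : ℕ → V) (t : ℕ), ∑ i ∈ Finset.range t, w (X i) =
      q * c * G.localTime X t x - q * c / (1 - q) * G.localTime X t y := by
    intro X t
    simp only [w, localTime, Finset.sum_sub_distrib, Finset.mul_sum]
  have hmax := G.walkLaw_exists_le_sum z F w hF hw k
  simp only [hsum] at hmax
  refine hmax.trans (mul_le_mul_of_nonneg_right ?_ (Real.exp_pos _).le)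
  calc F z ≤ 1 + q / (1 - q) := by
        simpa [F] using mul_le_of_le_one_right hqq (h.le_one z)
    _ = (1 - q)⁻¹ := by field_simp; ring

/-- Gaussian bound for the difference of the rescaled local times at `x` and `y` while the one at
`y` is at most `L`. -/
theorem IsPotential.walkLaw_localTime_sub_le {G : WeightedGraph V} {g : V → ℝ} {x y : V} {R : ℝ}
    (h : G.IsPotential g y x R⁻¹) (hR : 0 < R) (z : V) {r lam L : ℝ} (hr : 0 < r)
    (hlam : 0 ≤ lam) (hL : 0 < L) (hlL : lam * √(r⁻¹ * R) ≤ L) :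
    (G.walkLaw z).real {X : ℕ → V | ∃ t : ℕ,
        lam * √(r⁻¹ * R) ≤ G.localTime X t x / r - G.localTime X t y / r ∧
          G.localTime X t y / r ≤ L} ≤
      4 / 3 * Real.exp (-(lam ^ 2 / (8 * L))) := by
  set σ := √(r⁻¹ * R) with hσ
  have hσ0 : 0 < σ := Real.sqrt_pos.2 (by positivity)
  have hσ2 : R = r * σ ^ 2 := by
    rw [hσ, Real.sq_sqrt (by positivity)]; field_simp
  -- Balances the linear gain against the second-order error. The assumption `lam * σ ≤ L` keeps `q
  -- ≤ 1/4`, so `(1-q)⁻¹ ≤ 4/3`.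
  set q := lam * σ / (4 * L) with hq
  have hq0 : 0 ≤ q := by positivity
  have hq4 : q ≤ 1 / 4 := by
    rw [hq, div_le_iff₀ (by positivity)]; linarith
  have hinv : (1 - q)⁻¹ ≤ 4 / 3 := by
    rw [inv_le_comm₀ (by linarith) (by norm_num)]; linarith
  refine le_trans (measureReal_mono ?_ (measure_ne_top _ _))
    ((h.walkLaw_localTime_combination_le z hq0 (by linarith) (lam ^ 2 / (8 * L))).trans
      (mul_le_mul_of_nonneg_right hinv (Real.exp_pos _).le))
  rintro X ⟨t, h1, h2⟩
  refine ⟨t, ?_⟩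
  set a := G.localTime X t x / r with ha
  set b := G.localTime X t y / r with hb
  have hb0 : 0 ≤ b := div_nonneg (G.localTime_nonneg X t y) hr.le
  have hxa : G.localTime X t x = r * a := by rw [ha]; field_simp
  have hyb : G.localTime X t y = r * b := by rw [hb]; field_simp
  have hqR : q * R⁻¹ * r = lam / (4 * L * σ) := by
    rw [hσ2, hq]; field_simp
  set θ := lam / (4 * L * σ) with hθ
  have hθ0 : 0 ≤ θ := by positivity
  have hexp : q * R⁻¹ * G.localTime X t x - q * R⁻¹ / (1 - q) * G.localTime X t y =
      θ * (a - b) - θ * (q * (1 - q)⁻¹) * b := by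
    rw [hxa, hyb]
    have h1q : 1 - q ≠ 0 := by linarith
    calc q * R⁻¹ * (r * a) - q * R⁻¹ / (1 - q) * (r * b)
        = (q * R⁻¹ * r) * a - (q * R⁻¹ * r) / (1 - q) * b := by ring
      _ = _ := by rw [hqR]; field_simp; ring
  rw [hexp]
  -- The gain is at least `lam²/(4L)` and the error at most `lam²/(12L)`. This leaves `lam²/(6L)`,
  -- more than the exponent required.
  have e1 : θ * (lam * σ) ≤ θ * (a - b) := mul_le_mul_of_nonneg_left h1 hθ0
  have e2 : θ * (q * (1 - q)⁻¹) * b ≤ θ * (q * (4 / 3)) * L := by gcongr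
  have e3 : θ * (lam * σ) - θ * (q * (4 / 3)) * L = lam ^ 2 / (6 * L) := by
    rw [hθ, hq]; field_simp; ring
  have e4 : lam ^ 2 / (8 * L) ≤ lam ^ 2 / (6 * L) := by gcongr; norm_num
  linarith

/-- Exponential tail of the local time at `y` up to time `T m(G) r(G)`. -/
theorem walkLaw_localTime_ge_le (G : WeightedGraph V) (y z : V) (T k : ℝ) :
    (G.walkLaw z).real {X : ℕ → V | ∃ t : ℕ,
        (t : ℝ) ≤ T * G.totalMass * G.resistanceDiam ∧
          k ≤ G.localTime X t y / G.resistanceDiam} ≤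
      2 * Real.exp (2 * T - k / 2) := by
  classical
  obtain ⟨f, hf0, hfr, hfl⟩ := G.exists_poisson y
  have hr := G.resistanceDiam_pos
  have hm := G.totalMass_pos
  have hμ := G.vertexWeight_pos
  have hμr := G.one_le_vertexWeight_mul_resistanceDiam y
  set r := G.resistanceDiam
  set m := G.totalMass
  -- Since `1 ≤ F ≤ 2`, half of the gain `1/(μ_y r)` at `y` can be put in the exponent. The drift
  -- `1/(m r)` per step is charged twice, to leave room for the cross term at `y`.
  let F : V → ℝ := fun v => 1 + f v / r
  let w : V → ℝ := fun v =>
    1 / (2 * r) * (1 / G.vertexWeight y * Set.indicator {y} (fun _ => (1 : ℝ)) v) - 2 * (1 / (m * r))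
  have hF1 : ∀ v, 1 ≤ F v := fun v => le_add_of_nonneg_right (div_nonneg (hf0 v) hr.le)
  have hF2 : ∀ v, F v ≤ 2 := fun v => by
    have : f v / r ≤ 1 := (div_le_one hr).2 (hfr v)
    simp only [F]; linarith
  have hPF : ∀ v, ∑ u, G.transProb v u * F u =
      F v - 1 / r * (G.laplacian f v / G.vertexWeight v) := by
    intro v
    have h1 := G.sum_transProb_mul f v
    have h2 : ∑ u, G.transProb v u * F u =
        ∑ u, G.transProb v u + 1 / r * ∑ u, G.transProb v u * f u := by
      rw [Finset.mul_sum, ← Finset.sum_add_distrib]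
      exact Finset.sum_congr rfl fun u _ => by simp only [F]; ring
    rw [h2, h1, G.sum_transProb]
    simp only [F]
    ring
  have hw : ∀ v, Real.exp (w v) * ∑ u, G.transProb v u * F u ≤ F v := by
    intro v
    have hs0 : 0 ≤ 1 / (m * r) := by positivity
    rw [hPF, hfl]
    by_cases hvy : v = y
    · subst hvy
      have hβ0 : 0 ≤ 1 / (G.vertexWeight v * r) := by have := hμ v; positivity
      have hβ1 : 1 / (G.vertexWeight v * r) ≤ 1 := (div_le_one (by linarith)).2 hμr
      have hwv : w v = -(2⁻¹ * -(1 / (G.vertexWeight v * r)) + 2 * (1 / (m * r))) := by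
        simp only [w, Set.indicator_of_mem (Set.mem_singleton v)]
        have := (hμ v).ne'
        field_simp
        ring
      have hP : 1 / r * (((if v = v then 1 else 0) - G.vertexWeight v / m) / G.vertexWeight v) =
          1 / (G.vertexWeight v * r) - 1 / (m * r) := by
        have := (hμ v).ne'
        rw [if_pos rfl]
        field_simp
      rw [hwv, hP]
      generalize 1 / (G.vertexWeight v * r) = β at *
      generalize 1 / (m * r) = s at *
      rw [Real.exp_neg, inv_mul_le_iff₀ (Real.exp_pos _), Real.exp_add]
      have e1 : 1 + 2⁻¹ * -β ≤ Real.exp (2⁻¹ * -β) := by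
        linarith [Real.add_one_le_exp (2⁻¹ * -β)]
      have e2 : 1 + 2 * s ≤ Real.exp (2 * s) := by linarith [Real.add_one_le_exp (2 * s)]
      have e3 : (1 + 2⁻¹ * -β) * (1 + 2 * s) ≤ Real.exp (2⁻¹ * -β) * Real.exp (2 * s) :=
        mul_le_mul e1 e2 (by linarith) (Real.exp_pos _).le
      refine le_trans ?_ (mul_le_mul_of_nonneg_right e3 (by linarith [hF1 v]))
      have hFa := hF1 v
      have hFb := hF2 v
      -- It remains to see `(1 - β/2)(1 + 2s) F ≥ F - β + s`. `F ≤ 2` handles the `β` terms, while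
      -- `β ≤ 1` and `F ≥ 1` give `(2 - β) F ≥ 1` for the `s` terms.
      have e4 : 0 ≤ (2 - F v) * β := mul_nonneg (by linarith) hβ0
      have e5 : s * 1 ≤ s * ((2 - β) * F v) :=
        mul_le_mul_of_nonneg_left (by nlinarith) hs0
      nlinarith
    · have hwv : w v = -(2 * (1 / (m * r))) := by simp [w, hvy]
      have hP : 1 / r * (((if v = y then 1 else 0) - G.vertexWeight v / m) / G.vertexWeight v) =
          - (1 / (m * r)) := by
        have := (hμ v).ne'
        rw [if_neg hvy]
        field_simp
        ring
      rw [hwv, hP]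
      generalize 1 / (m * r) = s at *
      rw [Real.exp_neg, inv_mul_le_iff₀ (Real.exp_pos _)]
      have e2 : 1 + 2 * s ≤ Real.exp (2 * s) := by linarith [Real.add_one_le_exp (2 * s)]
      have hFa := hF1 v
      refine le_trans ?_ (mul_le_mul_of_nonneg_right e2 (by linarith))
      nlinarith
  have hmax := G.walkLaw_exists_le_sum z F w hF1 hw (k / 2 - 2 * T)
  refine le_trans (measureReal_mono ?_ (measure_ne_top _ _)) (hmax.trans ?_)
  · rintro X ⟨t, ht, hk⟩
    refine ⟨t, ?_⟩
    have hsum : ∑ i ∈ Finset.range t, w (X i) =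
        1 / 2 * (G.localTime X t y / r) - 2 * (t / (m * r)) := by
      simp only [w, Finset.sum_sub_distrib, ← Finset.mul_sum, Finset.sum_const,
        Finset.card_range, nsmul_eq_mul, localTime]
      field_simp
    have htT : (t : ℝ) / (m * r) ≤ T := by
      rw [div_le_iff₀ (by positivity)]; linarith
    rw [hsum]
    linarith
  · rw [neg_sub]
    exact mul_le_mul_of_nonneg_right (hF2 z) (Real.exp_pos _).le

/-- Two-sided version of `IsPotential.walkLaw_localTime_sub_le`, for the resistance metric. -/
theorem walkLaw_localTime_sub_le (G : WeightedGraph V) {x y : V} (hxy : x ≠ y) (z : V)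
    {lam L : ℝ} (hlam : 0 ≤ lam) (hL : 0 < L) (hlL : lam * √(G.rescaledResistance x y) ≤ L) :
    (G.walkLaw z).real {X : ℕ → V | ∃ t : ℕ,
        lam * √(G.rescaledResistance x y) ≤
          G.localTime X t x / G.resistanceDiam - G.localTime X t y / G.resistanceDiam ∧
          G.localTime X t y / G.resistanceDiam ≤ L} +
      (G.walkLaw z).real {X : ℕ → V | ∃ t : ℕ,
        lam * √(G.rescaledResistance x y) ≤
          G.localTime X t y / G.resistanceDiam - G.localTime X t x / G.resistanceDiam ∧
          G.localTime X t x / G.resistanceDiam ≤ L} ≤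
      8 / 3 * Real.exp (-(lam ^ 2 / (8 * L))) := by
  obtain ⟨hR, g, hg⟩ := G.exists_isPotential hxy
  have h1 := hg.one_sub.walkLaw_localTime_sub_le hR z G.resistanceDiam_pos hlam hL hlL
  have h2 := hg.walkLaw_localTime_sub_le hR z G.resistanceDiam_pos hlam hL hlL
  refine (add_le_add h1 h2).trans_eq ?_
  ring

end LocalTime

end

end WeightedGraph

/-! ### Assembly of the two bounds. -/

theorem theorem1p1 :
    (∃ c₂ : ℝ, 0 < c₂ ∧ ∀ T : ℝ, 0 < T → ∃ c₁ : ℝ, 0 < c₁ ∧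
      ∀ (V : Type u) [Fintype V] [Nontrivial V] [MeasurableSpace V] [DiscreteMeasurableSpace V]
        (G : WeightedGraph V) (x y z : V), x ≠ y → ∀ lam : ℝ, 0 ≤ lam →
        (G.walkLaw z).real {X : ℕ → V | ∃ t : ℕ,
            (t : ℝ) ≤ T * G.totalMass * G.resistanceDiam ∧
            lam * √(G.rescaledResistance x y) ≤
              (G.resistanceDiam)⁻¹ * |G.localTime X t x - G.localTime X t y|}
          ≤ c₁ * Real.exp (-c₂ * lam)) ∧
    (∀ (V : Type u) [Fintype V] [Nontrivial V] [MeasurableSpace V] [DiscreteMeasurableSpace V]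
        (G : WeightedGraph V) (x y z : V), x ≠ y → ∀ lam L : ℝ, 0 ≤ lam → 1 ≤ L →
        (G.walkLaw z).real {X : ℕ → V | ∃ t : ℕ,
            lam * √(G.rescaledResistance x y) ≤
              |min L (G.localTime X t x / G.resistanceDiam) -
                min L (G.localTime X t y / G.resistanceDiam)|}
          ≤ 2 * Real.exp (1 / 2 - lam ^ 2 / (8 * L))) := by
  -- `8/3` comes from the two Gaussian bounds, and `4 e^{2T}` from the two local time tails.
  refine ⟨⟨1 / 8, by norm_num, fun T hT => ⟨8 / 3 + 4 * Real.exp (2 * T), by positivity, ?_⟩⟩, ?_⟩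
  · intro V _ _ _ _ G x y z hxy lam hlam
    rcases hlam.eq_or_lt with rfl | hpos
    · refine measureReal_le_one.trans ?_
      rw [mul_zero, Real.exp_zero]
      linarith [Real.exp_pos (2 * T)]
    have hσ1 : √(G.rescaledResistance x y) ≤ 1 :=
      Real.sqrt_le_one.2 (G.rescaledResistance_le_one x y)
    -- The level is `L = lam`, admissible because the rescaled resistance is at most `1`.
    have hmain := G.walkLaw_localTime_sub_le hxy z hlam hpos (mul_le_of_le_one_right hlam hσ1)
    have hy := G.walkLaw_localTime_ge_le y z T lam
    have hx := G.walkLaw_localTime_ge_le x z T lam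
    have hr := G.resistanceDiam_pos
    refine le_trans (measureReal_mono (s₂ := (_ ∪ _) ∪ (_ ∪ _)) ?_ (measure_ne_top _ _))
      ((measureReal_union_le _ _).trans (add_le_add ((measureReal_union_le _ _).trans hmain)
        ((measureReal_union_le _ _).trans (add_le_add hy hx))) |>.trans ?_)
    · rintro X ⟨t, ht, h⟩
      have habs : (G.resistanceDiam)⁻¹ * |G.localTime X t x - G.localTime X t y| =
          |G.localTime X t x / G.resistanceDiam - G.localTime X t y / G.resistanceDiam| := by
        rw [← sub_div, abs_div, abs_of_pos hr, div_eq_inv_mul]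
      rw [habs] at h
      rcases le_total (G.localTime X t y / G.resistanceDiam) lam with hyl | hyl
      · rcases le_total (G.localTime X t x / G.resistanceDiam) lam with hxl | hxl
        · left
          rcases le_abs.1 h with h | h
          · exact Or.inl ⟨t, h, hyl⟩
          · exact Or.inr ⟨t, by linarith, hxl⟩
        · exact Or.inr (Or.inr ⟨t, ht, hxl⟩)
      · exact Or.inr (Or.inl ⟨t, ht, hyl⟩)
    · have e1 : lam ^ 2 / (8 * lam) = 1 / 8 * lam := by field_simp
      have e2 : Real.exp (2 * T - lam / 2) ≤ Real.exp (2 * T) * Real.exp (-(1 / 8) * lam) := by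
        rw [← Real.exp_add]
        exact Real.exp_le_exp.2 (by linarith)
      rw [e1, ← neg_mul, add_mul]
      linarith
  · intro V _ _ _ _ G x y z hxy lam L hlam hL
    have hL0 : 0 < L := by linarith
    have hexp : (4 : ℝ) / 3 ≤ Real.exp (1 / 2) := by linarith [Real.add_one_le_exp (1 / 2 : ℝ)]
    rcases hlam.eq_or_lt with rfl | hpos
    · refine measureReal_le_one.trans ?_
      norm_num at hexp ⊢
      linarith
    have hr := G.resistanceDiam_pos
    have hσ0 : 0 < √(G.rescaledResistance x y) :=
      Real.sqrt_pos.2 (mul_pos (inv_pos.2 hr) (G.exists_isPotential hxy).1)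
    have hu : 0 < lam * √(G.rescaledResistance x y) := mul_pos hpos hσ0
    have hnn : ∀ (X : ℕ → V) t v, 0 ≤ G.localTime X t v / G.resistanceDiam :=
      fun X t v => div_nonneg (G.localTime_nonneg X t v) hr.le
    -- Positivity of `u` excludes `b > L`, where the second truncation would already be maximal.
    have key : ∀ a b u : ℝ, 0 ≤ b → 0 < u → u ≤ min L a - min L b →
        u ≤ L ∧ u ≤ a - b ∧ b ≤ L := by
      intro a b u hb hu h
      have hbL : b ≤ L := by
        by_contra hlt
        rw [min_eq_left (not_le.1 hlt).le] at h
        linarith [min_le_left L a]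
      rw [min_eq_right hbL] at h
      exact ⟨by linarith [min_le_left L a], by linarith [min_le_right L a], hbL⟩
    by_cases hlL : lam * √(G.rescaledResistance x y) ≤ L
    · have hmain := G.walkLaw_localTime_sub_le hxy z hlam hL0 hlL
      refine le_trans (measureReal_mono (s₂ := _ ∪ _) ?_ (measure_ne_top _ _))
        (((measureReal_union_le _ _).trans hmain).trans ?_)
      · rintro X ⟨t, h⟩
        rcases le_abs.1 h with h | h
        · exact Or.inl ⟨t, (key _ _ _ (hnn X t y) hu h).2⟩
        · rw [neg_sub] at h
          exact Or.inr ⟨t, (key _ _ _ (hnn X t x) hu h).2⟩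
      · rw [sub_eq_add_neg, Real.exp_add, ← mul_assoc]
        exact mul_le_mul_of_nonneg_right (by linarith) (Real.exp_pos _).le
    -- Truncations at `L` of nonnegative numbers never differ by more than `L`, so the event is
    -- empty.
    · rw [show {X : ℕ → V | ∃ t : ℕ, lam * √(G.rescaledResistance x y) ≤
          |min L (G.localTime X t x / G.resistanceDiam) -
            min L (G.localTime X t y / G.resistanceDiam)|} = ∅ from ?_, measureReal_empty]
      · positivity
      · refine Set.eq_empty_of_forall_notMem ?_
        rintro X ⟨t, h⟩
        rcases le_abs.1 h with h | h
        · exact hlL (key _ _ _ (hnn X t y) hu h).1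
        · rw [neg_sub] at h
          exact hlL (key _ _ _ (hnn X t x) hu h).1
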